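/- Notation. For a smooth surjection $\pi\colon X\to M$ admitting smooth local sections, $X^{[p]}$ is the $p$-fold fibre product over $M$. A bundle gerbe $(Q,Y,N)$ is a smooth surjection $\pi_Y\colon Y\to N$ admitting local sections, a principal $\mathbb C^\times$-bundle $Q\to Y^{[2]}$, and a smooth associative product $m_Q\colon Q_{(y_2,y_3)}\otimes Q_{(y_1,y_2)}\to Q_{(y_1,y_3)}$ of $\mathbb C^\times$-bundles, also written $v\cdot w$; $e(y)\in Q_{(y,y)}$ denotes its identity section. A bundle 2-gerbe $(Q,Y,X,M)$ consists of a smooth surjection $\pi\colon X\to M$ admitting local sections, a bundle gerbe $(Q,Y,X^{[2]})$, and the following data. (a) A bundle gerbe morphism over $X^{[3]}$: a smooth map $m\colon Y_{(x_2,x_3)}\times Y_{(x_1,x_2)}\to Y_{(x_1,x_3)}$ and a smooth map of $\mathbb C^\times$-bundles $\hat m\colon Q_{(y_{23},y_{23}')}\otimes Q_{(y_{12},y_{12}')}\to Q_{(m(y_{23},y_{12}),\,m(y_{23}',y_{12}'))}$ covering it and commuting with the products $m_Q$. (b) A smooth section $\hat a(y_{34},y_{23},y_{12})\in Q_{(m(m(y_{34},y_{23}),y_{12}),\;m(y_{34},m(y_{23},y_{12})))}$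 that descends to $X^{[4]}$, that is, for $u_{ij}\in Q_{(y_{ij},y_{ij}')}$, $$\hat m(u_{34}\otimes\hat m(u_{23}\otimes u_{12}))\cdot\hat a(y_{34},y_{23},y_{12})=\hat a(y_{34}',y_{23}',y_{12}')\cdot\hat m(\hat m(u_{34}\otimes u_{23})\otimes u_{12}),$$ and that satisfies the coherency condition $$\hat m(e(y_{45})\otimes\hat a(y_{34},y_{23},y_{12}))\cdot\hat a(y_{45},m(y_{34},y_{23}),y_{12})\cdot\hat m(\hat a(y_{45},y_{34},y_{23})\otimes e(y_{12}))=\hat a(y_{45},y_{34},m(y_{23},y_{12}))\cdot\hat a(m(y_{45},y_{34}),y_{23},y_{12}).$$ Proposition. Let $(Q,Y,X,M)$ be a bundle 2-gerbe, let $p\in M$ and $X_p=\pi^{-1}(p)$. (1) There is a map of sets $I\colon X_p\to Y$ with $I(x)\in Y_{(x,x)}$ for all $x\in X_p$. (2) For every such $I$ there are families of points $\mathrm{id}_L(y)\in Q_{(y,\,m(y,I(x_1)))}$ and $\mathrm{id}_R(y)\in Q_{(y,\,m(I(x_2),y))}$, for $y\in Y_{(x_1,x_2)}$ and $x_1,x_2\in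 X_p$, which are natural, i.e. for $u\in Q_{(y,y')}$ $$\hat m(u\otimes e(I(x_1)))\cdot\mathrm{id}_L(y)=\mathrm{id}_L(y')\cdot u,\qquad \hat m(e(I(x_2))\otimes u)\cdot\mathrm{id}_R(y)=\mathrm{id}_R(y')\cdot u,$$ and which satisfy, for all $x\in X_p$ and all $y\in Y_{(x_1,x_2)}$, $$\mathrm{id}_L(I(x))=\mathrm{id}_R(I(x)),$$ $$\hat a(I(x_2),I(x_2),y)\cdot\hat m(\mathrm{id}_L(I(x_2))\otimes e(y))=\hat m(e(I(x_2))\otimes\mathrm{id}_R(y)),$$ $$\hat a(y,I(x_1),I(x_1))\cdot\hat m(\mathrm{id}_L(y)\otimes e(I(x_1)))=\hat m(e(y)\otimes\mathrm{id}_R(I(x_1))).$$ (3) For every $I$, $\mathrm{id}_L$, $\mathrm{id}_R$ as in (1) and (2) the following is a bicategory $\mathcal Q_p$. Its objects are the points of $X_p$; the 1-arrows $x\to x'$ are the points of $Y_{(x,x')}$; the 2-arrows $y\Rightarrow y'$ are the points of $Q_{(y,y')}$, composed by $m_Q$, with identities $e(y)$; the composition functor $\mathrm{Hom}(x_2,x_3)\times\mathrm{Hom}(x_1,x_2)\to\mathrm{Hom}(x_1,x_3)$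 is $m$ on 1-arrows and $\hat m$ on 2-arrows; the associativity isomorphism $(y_{34}\circ y_{23})\circ y_{12}\Rightarrow y_{34}\circ(y_{23}\circ y_{12})$ is $\hat a(y_{34},y_{23},y_{12})$; the identity 1-arrow of $x$ is $I(x)$; and the identity isomorphisms $y\Rightarrow y\circ I(x_1)$ and $y\Rightarrow I(x_2)\circ y$ are $\mathrm{id}_L(y)$ and $\mathrm{id}_R(y)$. -/

import Mathlib

open scoped Manifold ContDiff
open CategoryTheory

universe u

/-- A smooth (Hausdorff) manifold without boundary, modelled on a real normed space. -/
structure SmoothManifold where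
  carrier : Type u
  E : Type u
  H : Type u
  [normedE : NormedAddCommGroup E]
  [spaceE : NormedSpace ℝ E]
  [topH : TopologicalSpace H]
  model : ModelWithCorners ℝ E H
  [boundaryless : model.Boundaryless]
  [top : TopologicalSpace carrier]
  [hausdorff : T2Space carrier]
  [charted : ChartedSpace H carrier]
  [isManifold : IsManifold model ∞ carrier]

namespace SmoothManifold

instance : CoeSort SmoothManifold.{u} (Type u) := ⟨SmoothManifold.carrier⟩

attribute [instance] normedE spaceE topH boundaryless top hausdorff charted isManifold

/-- The product of two manifolds. -/
@[reducible]
noncomputable def prod (A B : SmoothManifold.{u}) : SmoothManifold.{u} where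
  carrier := A.carrier × B.carrier
  E := A.E × B.E
  H := ModelProd A.H B.H
  model := A.model.prod B.model

/-- Smoothness of a map on a subset `S` of a manifold `A`. If `S` is a submanifold of `A`, for
instance a fibre product inside a product, then this is smoothness of the restriction to `S`; the
values of `f` outside `S` play no role. -/
def SmoothOn {A B : SmoothManifold.{u}} (f : A → B) (S : Set A) : Prop :=
  ContMDiffOn A.model B.model ∞ f S

/-- `p : A → B`, with image in `S ⊆ B`, is smooth, surjective onto `S`, and admits smooth local
sections over `S`. -/
structure IsSurjectionWithLocalSections {A B : SmoothManifold.{u}} (p : A → B) (S : Set B) :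
    Prop where
  smooth : SmoothOn p Set.univ
  range_eq : Set.range p = S
  local_sections : ∀ b ∈ S, ∃ U : Set B, IsOpen U ∧ b ∈ U ∧
    ∃ s : B → A, SmoothOn s (S ∩ U) ∧ ∀ c ∈ S ∩ U, p (s c) = c

end SmoothManifold

open SmoothManifold

/-- A smooth principal `ℂˣ`-bundle over a (sub)manifold `S` of `B`. As `ℂˣ` is commutative, the
action is written on the left. -/
structure CStarBundle (B : SmoothManifold.{u}) (S : Set B) where
  total : SmoothManifold.{u}
  proj : total → B
  [action : MulAction ℂˣ total]
  proj_smooth : SmoothOn proj Set.univ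
  proj_mem : ∀ q, proj q ∈ S
  action_smooth : ContMDiff (𝓘(ℝ, ℂ).prod total.model) total.model ∞
    (fun p : ℂˣ × total => p.1 • p.2)
  proj_smul : ∀ (z : ℂˣ) (q : total), proj (z • q) = proj q
  free : ∀ (z : ℂˣ) (q : total), z • q = q → z = 1
  transitive : ∀ q q' : total, proj q = proj q' → ∃ z : ℂˣ, q' = z • q
  /-- Local triviality: near each point of `S` there are a smooth local section `s` and a smooth
  function `t` such that `q ↦ (proj q, t q)` is inverse to `(b, z) ↦ z • s b`. -/
  locally_trivial : ∀ b ∈ S, ∃ U : Set B, IsOpen U ∧ b ∈ U ∧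
    ∃ (s : B → total) (t : total → ℂˣ),
      SmoothOn s (S ∩ U) ∧ (∀ c ∈ S ∩ U, proj (s c) = c) ∧
      ContMDiffOn total.model 𝓘(ℝ, ℂ) ∞ t (proj ⁻¹' U) ∧
      ∀ q, proj q ∈ U → q = t q • s (proj q)

attribute [instance] CStarBundle.action

/-- A bundle gerbe `(Q, Y, S)` over a (sub)manifold `S` of `B`. For `q` in the fibre
`Q_{(y₁, y₂)}` the points `y₁`, `y₂` are the two components of `Q.proj q`. -/
structure BundleGerbe (B : SmoothManifold.{u}) (S : Set B) where
  Y : SmoothManifold.{u}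
  proj : Y → B
  proj_surj : IsSurjectionWithLocalSections proj S
  /-- The `ℂˣ`-bundle `Q → Y^{[2]}`. -/
  Q : CStarBundle (Y.prod Y) {p | proj p.1 = proj p.2}
  /-- The bundle gerbe product `Q_{(y₂, y₃)} ⊗ Q_{(y₁, y₂)} → Q_{(y₁, y₃)}`, as a map defined on
  pairs and equivariant in each variable, which is the same as a map of `ℂˣ`-bundles on the
  contracted product. Values on non-composable pairs play no role. -/
  mul : Q.total → Q.total → Q.total
  mul_smooth : SmoothOn (A := Q.total.prod Q.total) (fun p => mul p.1 p.2)
    {p | (Q.proj p.1).1 = (Q.proj p.2).2}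
  proj_mul : ∀ v w, (Q.proj v).1 = (Q.proj w).2 →
    Q.proj (mul v w) = ((Q.proj w).1, (Q.proj v).2)
  smul_mul : ∀ (z : ℂˣ) v w, (Q.proj v).1 = (Q.proj w).2 → mul (z • v) w = z • mul v w
  mul_smul : ∀ (z : ℂˣ) v w, (Q.proj v).1 = (Q.proj w).2 → mul v (z • w) = z • mul v w
  mul_assoc : ∀ v w t, (Q.proj v).1 = (Q.proj w).2 → (Q.proj w).1 = (Q.proj t).2 →
    mul (mul v w) t = mul v (mul w t)

namespace BundleGerbe

variable {B : SmoothManifold.{u}} {S : Set B} (G : BundleGerbe B S)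

theorem exists_identity (y : G.Y) :
    ∃ e : G.Q.total, G.Q.proj e = (y, y) ∧ G.mul e e = e := by
  obtain ⟨U, -, hU, s, t, -, hs, -, -⟩ := G.Q.locally_trivial (y, y) rfl
  have h := hs (y, y) ⟨rfl, hU⟩
  have hc : (G.Q.proj (s (y, y))).1 = (G.Q.proj (s (y, y))).2 := by rw [h]
  obtain ⟨z, hz⟩ := G.Q.transitive (s (y, y)) (G.mul (s (y, y)) (s (y, y)))
    (by rw [G.proj_mul _ _ hc, h])
  refine ⟨z⁻¹ • s (y, y), by rw [G.Q.proj_smul, h], ?_⟩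
  have hc' : (G.Q.proj (s (y, y))).1 = (G.Q.proj (z⁻¹ • s (y, y))).2 := by
    rw [G.Q.proj_smul, h]
  rw [G.smul_mul _ _ _ hc', G.mul_smul _ _ _ hc, hz, inv_smul_smul]

/-- The identity section: `e y` is the (unique) idempotent for the product in `Q_{(y, y)}`. -/
noncomputable def e (y : G.Y) : G.Q.total := (G.exists_identity y).choose

end BundleGerbe

/-- A bundle 2-gerbe `(Q, Y, X, M)`. -/
structure BundleTwoGerbe where
  M : SmoothManifold.{u}
  X : SmoothManifold.{u}
  π : X → M
  π_surj : IsSurjectionWithLocalSections π Set.univ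
  /-- The bundle gerbe `(Q, Y, X^{[2]})`. -/
  gerbe : BundleGerbe (X.prod X) {p | π p.1 = π p.2}
  /-- The map `Y_{(x₂, x₃)} × Y_{(x₁, x₂)} → Y_{(x₁, x₃)}` underlying the bundle gerbe morphism
  `π₁⁻¹Q ⊗ π₃⁻¹Q → π₂⁻¹Q` over `X^{[3]}`. -/
  m : gerbe.Y → gerbe.Y → gerbe.Y
  m_smooth : SmoothOn (A := gerbe.Y.prod gerbe.Y) (fun p => m p.1 p.2)
    {p | (gerbe.proj p.1).1 = (gerbe.proj p.2).2}
  proj_m : ∀ y y', (gerbe.proj y).1 = (gerbe.proj y').2 →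
    gerbe.proj (m y y') = ((gerbe.proj y').1, (gerbe.proj y).2)
  /-- The map of `ℂˣ`-bundles
  `Q_{(y₂₃, y₂₃')} ⊗ Q_{(y₁₂, y₁₂')} → Q_{(m(y₂₃, y₁₂), m(y₂₃', y₁₂'))}`,
  as a map defined on pairs and equivariant in each variable. -/
  mHat : gerbe.Q.total → gerbe.Q.total → gerbe.Q.total
  mHat_smooth : SmoothOn (A := gerbe.Q.total.prod gerbe.Q.total) (fun p => mHat p.1 p.2)
    {p | (gerbe.proj (gerbe.Q.proj p.1).1).1 = (gerbe.proj (gerbe.Q.proj p.2).1).2}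
  proj_mHat : ∀ v w, (gerbe.proj (gerbe.Q.proj v).1).1 = (gerbe.proj (gerbe.Q.proj w).1).2 →
    gerbe.Q.proj (mHat v w) =
      (m (gerbe.Q.proj v).1 (gerbe.Q.proj w).1, m (gerbe.Q.proj v).2 (gerbe.Q.proj w).2)
  smul_mHat : ∀ (z : ℂˣ) v w,
    (gerbe.proj (gerbe.Q.proj v).1).1 = (gerbe.proj (gerbe.Q.proj w).1).2 →
    mHat (z • v) w = z • mHat v w
  mHat_smul : ∀ (z : ℂˣ) v w,
    (gerbe.proj (gerbe.Q.proj v).1).1 = (gerbe.proj (gerbe.Q.proj w).1).2 →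
    mHat v (z • w) = z • mHat v w
  /-- The morphism commutes with the bundle gerbe products. -/
  mHat_mul : ∀ v' v w' w,
    (gerbe.Q.proj v').1 = (gerbe.Q.proj v).2 → (gerbe.Q.proj w').1 = (gerbe.Q.proj w).2 →
    (gerbe.proj (gerbe.Q.proj v).1).1 = (gerbe.proj (gerbe.Q.proj w).1).2 →
    mHat (gerbe.mul v' v) (gerbe.mul w' w) = gerbe.mul (mHat v' w') (mHat v w)
  /-- The associator section of `(m₁, m₂)⁻¹Q` over `Y₁₂₃₄`, where `m₁ = m ∘ (m ⊗ 1)` and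
  `m₂ = m ∘ (1 ⊗ m)`. -/
  aHat : gerbe.Y → gerbe.Y → gerbe.Y → gerbe.Q.total
  aHat_smooth : SmoothOn (A := gerbe.Y.prod (gerbe.Y.prod gerbe.Y))
    (fun p => aHat p.1 p.2.1 p.2.2)
    {p | (gerbe.proj p.1).1 = (gerbe.proj p.2.1).2 ∧
      (gerbe.proj p.2.1).1 = (gerbe.proj p.2.2).2}
  proj_aHat : ∀ y₃₄ y₂₃ y₁₂, (gerbe.proj y₃₄).1 = (gerbe.proj y₂₃).2 →
    (gerbe.proj y₂₃).1 = (gerbe.proj y₁₂).2 →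
    gerbe.Q.proj (aHat y₃₄ y₂₃ y₁₂) = (m (m y₃₄ y₂₃) y₁₂, m y₃₄ (m y₂₃ y₁₂))
  /-- Compatibility with the descent isomorphism: the section descends to `X^{[4]}`, that is, it is
  a transformation from `m₁` to `m₂`. -/
  aHat_descent : ∀ v₃₄ v₂₃ v₁₂,
    (gerbe.proj (gerbe.Q.proj v₃₄).1).1 = (gerbe.proj (gerbe.Q.proj v₂₃).1).2 →
    (gerbe.proj (gerbe.Q.proj v₂₃).1).1 = (gerbe.proj (gerbe.Q.proj v₁₂).1).2 →
    gerbe.mul (mHat v₃₄ (mHat v₂₃ v₁₂))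
        (aHat (gerbe.Q.proj v₃₄).1 (gerbe.Q.proj v₂₃).1 (gerbe.Q.proj v₁₂).1) =
      gerbe.mul (aHat (gerbe.Q.proj v₃₄).2 (gerbe.Q.proj v₂₃).2 (gerbe.Q.proj v₁₂).2)
        (mHat (mHat v₃₄ v₂₃) v₁₂)
  /-- The coherency condition over `X^{[5]}`. -/
  aHat_coherence : ∀ y₄₅ y₃₄ y₂₃ y₁₂, (gerbe.proj y₄₅).1 = (gerbe.proj y₃₄).2 →
    (gerbe.proj y₃₄).1 = (gerbe.proj y₂₃).2 → (gerbe.proj y₂₃).1 = (gerbe.proj y₁₂).2 →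
    gerbe.mul (mHat (gerbe.e y₄₅) (aHat y₃₄ y₂₃ y₁₂))
        (gerbe.mul (aHat y₄₅ (m y₃₄ y₂₃) y₁₂) (mHat (aHat y₄₅ y₃₄ y₂₃) (gerbe.e y₁₂))) =
      gerbe.mul (aHat y₄₅ y₃₄ (m y₂₃ y₁₂)) (aHat (m y₄₅ y₃₄) y₂₃ y₁₂)

namespace BundleTwoGerbe

variable (G : BundleTwoGerbe.{u})

/-- The manifold `Y`. -/
abbrev Y : Type u := G.gerbe.Y

/-- The total space `Q`. -/
abbrev Q : Type u := G.gerbe.Q.total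

/-- The projection `Y → X^{[2]}`. -/
abbrev projY (y : G.Y) : G.X × G.X := G.gerbe.proj y

/-- The projection `Q → Y^{[2]}`. -/
abbrev projQ (q : G.Q) : G.Y × G.Y := G.gerbe.Q.proj q

/-- The bundle gerbe product of `Q`. -/
abbrev mul (v w : G.Q) : G.Q := G.gerbe.mul v w

/-- The identity section of `Q`. -/
noncomputable abbrev e (y : G.Y) : G.Q := G.gerbe.e y

/-- The fibre `X_p` of `π : X → M`. -/
def Fibre (p : G.M) : Type u := {x : G.X // G.π x = p}

variable {G} {p : G.M}

/-- A set-theoretic section `I` of `Y → X^{[2]}` over the diagonal of `X_p`. -/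
def IsDiagonalSection (I : G.Fibre p → G.Y) : Prop :=
  ∀ x, G.projY (I x) = (x.1, x.1)

/-- The choices of identity isomorphisms `idL y : y ⇒ m(y, I(x₁))` and `idR y : y ⇒ m(I(x₂), y)`
for `y ∈ Y_{(x₁, x₂)}`, with `x₁, x₂ ∈ X_p`. -/
structure IsIdentityChoice (I : G.Fibre p → G.Y) (idL idR : G.Y → G.Q) : Prop where
  projQ_idL : ∀ (x₁ x₂ : G.Fibre p) (y : G.Y), G.projY y = (x₁.1, x₂.1) →
    G.projQ (idL y) = (y, G.m y (I x₁))
  projQ_idR : ∀ (x₁ x₂ : G.Fibre p) (y : G.Y), G.projY y = (x₁.1, x₂.1) →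
    G.projQ (idR y) = (y, G.m (I x₂) y)
  /-- `idL` descends to a section of a `ℂˣ`-bundle on `X_p × X_p`. -/
  idL_descent : ∀ (x₁ x₂ : G.Fibre p) (q : G.Q), G.projY (G.projQ q).1 = (x₁.1, x₂.1) →
    G.mul (G.mHat q (G.e (I x₁))) (idL (G.projQ q).1) = G.mul (idL (G.projQ q).2) q
  /-- `idR` descends to a section of a `ℂˣ`-bundle on `X_p × X_p`. -/
  idR_descent : ∀ (x₁ x₂ : G.Fibre p) (q : G.Q), G.projY (G.projQ q).1 = (x₁.1, x₂.1) →
    G.mul (G.mHat (G.e (I x₂)) q) (idR (G.projQ q).1) = G.mul (idR (G.projQ q).2) q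
  /-- The two choices agree on the identity 1-arrows. -/
  idL_eq_idR : ∀ x : G.Fibre p, idL (I x) = idR (I x)
  /-- The normalisation that fixes `idR`. -/
  idR_normalised : ∀ (x₁ x₂ : G.Fibre p) (y : G.Y), G.projY y = (x₁.1, x₂.1) →
    G.mul (G.aHat (I x₂) (I x₂) y) (G.mHat (idL (I x₂)) (G.e y)) =
      G.mHat (G.e (I x₂)) (idR y)
  /-- The normalisation that fixes `idL`. -/
  idL_normalised : ∀ (x₁ x₂ : G.Fibre p) (y : G.Y), G.projY y = (x₁.1, x₂.1) →
    G.mul (G.aHat y (I x₁) (I x₁)) (G.mHat (idL y) (G.e (I x₁))) =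
      G.mHat (G.e y) (idR (I x₁))

open scoped CategoryTheory.Bicategory

/-- The bicategory `Q_p`: a bicategory with the points of `X_p` as objects, the points of
`Y_{(x, x')}` as 1-arrows `x ⟶ x'` and the points of `Q_{(y, y')}` as 2-arrows `y ⟶ y'`, and with
the structure prescribed by the bundle 2-gerbe and the choices `I`, `idL`, `idR`.
In Mathlib `f ≫ g` is `g ∘ f`, and the associator and the unitors `α_`, `λ_`, `ρ_` point in the
direction opposite to that of `aHat`, `idL`, `idR`. -/
structure FibreBicategory (I : G.Fibre p → G.Y) (idL idR : G.Y → G.Q) where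
  [bicategory : Bicategory.{u, u} (G.Fibre p)]
  oneArrow : ∀ {x x' : G.Fibre p}, (x ⟶ x') ≃ {y : G.Y // G.projY y = (x.1, x'.1)}
  twoArrow : ∀ {x x' : G.Fibre p} {f g : x ⟶ x'},
    (f ⟶ g) ≃ {q : G.Q // G.projQ q = ((oneArrow f).1, (oneArrow g).1)}
  /-- Composition of 2-arrows is the bundle gerbe product, and its units are given by `e`. -/
  twoArrow_comp : ∀ {x x' : G.Fibre p} {f g h : x ⟶ x'} (η : f ⟶ g) (θ : g ⟶ h),
    (twoArrow (η ≫ θ)).1 = G.mul (twoArrow θ).1 (twoArrow η).1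
  twoArrow_id : ∀ {x x' : G.Fibre p} (f : x ⟶ x'), (twoArrow (𝟙 f)).1 = G.e (oneArrow f).1
  /-- The composition functor is given by `m` on 1-arrows and by `mHat` on 2-arrows. -/
  oneArrow_comp : ∀ {x₁ x₂ x₃ : G.Fibre p} (f : x₁ ⟶ x₂) (g : x₂ ⟶ x₃),
    (oneArrow (f ≫ g)).1 = G.m (oneArrow g).1 (oneArrow f).1
  twoArrow_hcomp : ∀ {x₁ x₂ x₃ : G.Fibre p} {f f' : x₁ ⟶ x₂} {g g' : x₂ ⟶ x₃}
    (η : f ⟶ f') (θ : g ⟶ g'),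
    (twoArrow ((η ▷ g) ≫ (f' ◁ θ))).1 = G.mHat (twoArrow θ).1 (twoArrow η).1
  twoArrow_whiskerLeft : ∀ {x₁ x₂ x₃ : G.Fibre p} (f : x₁ ⟶ x₂) {g g' : x₂ ⟶ x₃} (θ : g ⟶ g'),
    (twoArrow (f ◁ θ)).1 = G.mHat (twoArrow θ).1 (G.e (oneArrow f).1)
  twoArrow_whiskerRight : ∀ {x₁ x₂ x₃ : G.Fibre p} {f f' : x₁ ⟶ x₂} (η : f ⟶ f') (g : x₂ ⟶ x₃),
    (twoArrow (η ▷ g)).1 = G.mHat (G.e (oneArrow g).1) (twoArrow η).1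
  /-- The associativity isomorphism is given by `aHat`. -/
  twoArrow_associator : ∀ {x₁ x₂ x₃ x₄ : G.Fibre p} (f : x₁ ⟶ x₂) (g : x₂ ⟶ x₃) (h : x₃ ⟶ x₄),
    (twoArrow (α_ f g h).inv).1 = G.aHat (oneArrow h).1 (oneArrow g).1 (oneArrow f).1
  /-- The identity 1-arrows are given by `I`, the identity isomorphisms by `idL` and `idR`. -/
  oneArrow_id : ∀ x : G.Fibre p, (oneArrow (𝟙 x)).1 = I x
  twoArrow_leftUnitor : ∀ {x x' : G.Fibre p} (f : x ⟶ x'),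
    (twoArrow (λ_ f).inv).1 = idL (oneArrow f).1
  twoArrow_rightUnitor : ∀ {x x' : G.Fibre p} (f : x ⟶ x'),
    (twoArrow (ρ_ f).inv).1 = idR (oneArrow f).1

end BundleTwoGerbe

/-!
The points of `Q` over `(y, y')` form a `ℂˣ`-torsor, and every structure map of the 2-gerbe is
equivariant, so composing or whiskering with a fixed arrow is a bijection on 2-arrows. Hence any
loop `I x` can be cancelled, and it is isomorphic to its square because no torsor is empty: it is a
unit in the sense of Saavedra and Kock. Given an isomorphism `I x ≅ I x ∘ I x`, cancellation
shows that the two normalisation equations have unique solutions `idL` and `idR`. They are natural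
because both sides of the naturality square agree after whiskering with `I x`, and the triangle
identity is the pentagon with `I x` in the two middle positions, after cancellation. Finally the
triangle identity gives `idL (I x) = idR (I x)`, both being the chosen isomorphism.
-/

universe v w

/-- A bicategory without identity 1-arrows: the axioms are those of `CategoryTheory.Bicategory` that
do not mention identity 1-arrows, with the compatibilities of the associator stated as naturality
squares. It is what `m`, `mHat` and `aHat` define before any identity 1-arrow is chosen. -/
class Semibicategory (B : Type u) [Quiver.{v} B] [∀ a b : B, Category.{w} (a ⟶ b)] where
  comp {a b c : B} (f : a ⟶ b) (g : b ⟶ c) : a ⟶ c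
  whiskerLeft {a b c : B} (f : a ⟶ b) {g g' : b ⟶ c} (η : g ⟶ g') : comp f g ⟶ comp f g'
  whiskerRight {a b c : B} {f f' : a ⟶ b} (η : f ⟶ f') (g : b ⟶ c) : comp f g ⟶ comp f' g
  associator {a b c d : B} (f : a ⟶ b) (g : b ⟶ c) (h : c ⟶ d) :
    comp (comp f g) h ≅ comp f (comp g h)
  whiskerLeft_id {a b c : B} (f : a ⟶ b) (g : b ⟶ c) : whiskerLeft f (𝟙 g) = 𝟙 (comp f g)
  whiskerLeft_comp {a b c : B} (f : a ⟶ b) {g g' g'' : b ⟶ c} (η : g ⟶ g') (θ : g' ⟶ g'') :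
    whiskerLeft f (η ≫ θ) = whiskerLeft f η ≫ whiskerLeft f θ
  id_whiskerRight {a b c : B} (f : a ⟶ b) (g : b ⟶ c) : whiskerRight (𝟙 f) g = 𝟙 (comp f g)
  comp_whiskerRight {a b c : B} {f f' f'' : a ⟶ b} (η : f ⟶ f') (θ : f' ⟶ f'') (g : b ⟶ c) :
    whiskerRight (η ≫ θ) g = whiskerRight η g ≫ whiskerRight θ g
  whisker_exchange {a b c : B} {f f' : a ⟶ b} {g g' : b ⟶ c} (η : f ⟶ f') (θ : g ⟶ g') :
    whiskerLeft f θ ≫ whiskerRight η g' = whiskerRight η g ≫ whiskerLeft f' θ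
  associator_naturality_left {a b c d : B} {f f' : a ⟶ b} (η : f ⟶ f') (g : b ⟶ c) (h : c ⟶ d) :
    whiskerRight (whiskerRight η g) h ≫ (associator f' g h).hom =
      (associator f g h).hom ≫ whiskerRight η (comp g h)
  associator_naturality_middle {a b c d : B} (f : a ⟶ b) {g g' : b ⟶ c} (η : g ⟶ g')
    (h : c ⟶ d) :
    whiskerRight (whiskerLeft f η) h ≫ (associator f g' h).hom =
      (associator f g h).hom ≫ whiskerLeft f (whiskerRight η h)
  associator_naturality_right {a b c d : B} (f : a ⟶ b) (g : b ⟶ c) {h h' : c ⟶ d}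
    (η : h ⟶ h') :
    whiskerLeft (comp f g) η ≫ (associator f g h').hom =
      (associator f g h).hom ≫ whiskerLeft f (whiskerLeft g η)
  pentagon {a b c d e : B} (f : a ⟶ b) (g : b ⟶ c) (h : c ⟶ d) (k : d ⟶ e) :
    whiskerRight (associator f g h).hom k ≫ (associator f (comp g h) k).hom ≫
        whiskerLeft f (associator g h k).hom =
      (associator (comp f g) h k).hom ≫ (associator f g (comp h k)).hom

namespace Semibicategory

local infixr:80 " ≫₁ " => comp
-- The scope `Manifold` gives `≫` a second meaning with precedence 100; these have to bind tighter.
local infixr:101 " ◁ " => whiskerLeft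
local infixl:101 " ▷ " => whiskerRight
local notation "α_" => associator

variable {B : Type u} [Quiver.{v} B] [∀ a b : B, Category.{w} (a ⟶ b)] [Semibicategory B]
  {a b c : B}

/-- Whiskering with `f` on the left, as a functor between categories of 1-arrows. -/
def precomp (c : B) (f : a ⟶ b) : (b ⟶ c) ⥤ (a ⟶ c) where
  obj g := f ≫₁ g
  map η := f ◁ η
  map_id := whiskerLeft_id f
  map_comp := whiskerLeft_comp f

/-- Whiskering with `g` on the right, as a functor between categories of 1-arrows. -/
def postcomp (a : B) (g : b ⟶ c) : (a ⟶ b) ⥤ (a ⟶ c) where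
  obj f := f ≫₁ g
  map η := η ▷ g
  map_id f := id_whiskerRight f g
  map_comp η θ := comp_whiskerRight η θ g

instance {f f' : a ⟶ b} (η : f ⟶ f') [IsIso η] (g : b ⟶ c) : IsIso (η ▷ g) :=
  inferInstanceAs (IsIso ((postcomp a g).map η))

/-- A unit in the sense of Saavedra and Kock: a 1-arrow which is isomorphic to its square and with
which one can cancel. Coherent identity isomorphisms can be reconstructed from it, so that it plays
the role of an identity 1-arrow. -/
structure SaavedraUnit (a : B) where
  arrow : a ⟶ a
  iso : arrow ≅ arrow ≫₁ arrow
  precomp_full : ∀ b, (precomp b arrow).Full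
  precomp_faithful : ∀ b, (precomp b arrow).Faithful
  postcomp_full : ∀ b, (postcomp b arrow).Full
  postcomp_faithful : ∀ b, (postcomp b arrow).Faithful

namespace SaavedraUnit

attribute [instance] precomp_full precomp_faithful postcomp_full postcomp_faithful

theorem whiskerLeft_cancel (u : SaavedraUnit a) {f g : a ⟶ b} {η θ : f ⟶ g}
    (h : u.arrow ◁ η = u.arrow ◁ θ) : η = θ :=
  (precomp b u.arrow).map_injective h

theorem whiskerRight_cancel (u : SaavedraUnit b) {f g : a ⟶ b} {η θ : f ⟶ g}
    (h : η ▷ u.arrow = θ ▷ u.arrow) : η = θ :=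
  (postcomp a u.arrow).map_injective h

/-- The inverse of the left unitor of `u`, the paper's `id_L`; `idL_unique` characterises it. -/
noncomputable def idL (u : SaavedraUnit a) (f : a ⟶ b) : f ≅ u.arrow ≫₁ f :=
  (precomp b u.arrow).preimageIso ((postcomp a f).mapIso u.iso ≪≫ α_ u.arrow u.arrow f)

/-- The inverse of the right unitor of `u`, the paper's `id_R`; `idR_unique` characterises it. -/
noncomputable def idR (u : SaavedraUnit b) (f : a ⟶ b) : f ≅ f ≫₁ u.arrow :=
  (postcomp a u.arrow).preimageIso ((precomp b f).mapIso u.iso ≪≫ (α_ f u.arrow u.arrow).symm)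

theorem whiskerLeft_idL (u : SaavedraUnit a) (f : a ⟶ b) :
    u.arrow ◁ (u.idL f).hom = u.iso.hom ▷ f ≫ (α_ u.arrow u.arrow f).hom :=
  (precomp b u.arrow).map_preimage _

theorem idR_whiskerRight (u : SaavedraUnit b) (f : a ⟶ b) :
    (u.idR f).hom ▷ u.arrow = f ◁ u.iso.hom ≫ (α_ f u.arrow u.arrow).inv :=
  (postcomp a u.arrow).map_preimage _

theorem whiskerLeft_idL_comp_associator_inv (u : SaavedraUnit a) (f : a ⟶ b) :
    u.arrow ◁ (u.idL f).hom ≫ (α_ u.arrow u.arrow f).inv = u.iso.hom ▷ f :=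
  (Iso.comp_inv_eq _).2 (u.whiskerLeft_idL f)

theorem idL_unique (u : SaavedraUnit a) {f : a ⟶ b} {η : f ⟶ u.arrow ≫₁ f}
    (h : u.arrow ◁ η ≫ (α_ u.arrow u.arrow f).inv = u.iso.hom ▷ f) : η = (u.idL f).hom :=
  u.whiskerLeft_cancel (((Iso.comp_inv_eq _).1 h).trans (u.whiskerLeft_idL f).symm)

theorem idR_unique (u : SaavedraUnit b) {f : a ⟶ b} {η : f ⟶ f ≫₁ u.arrow}
    (h : η ▷ u.arrow = f ◁ u.iso.hom ≫ (α_ f u.arrow u.arrow).inv) : η = (u.idR f).hom :=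
  u.whiskerRight_cancel (h.trans (u.idR_whiskerRight f).symm)

theorem idL_naturality (u : SaavedraUnit a) {f f' : a ⟶ b} (η : f ⟶ f') :
    (u.idL f).hom ≫ u.arrow ◁ η = η ≫ (u.idL f').hom := by
  apply u.whiskerLeft_cancel
  simp only [whiskerLeft_comp, whiskerLeft_idL, Category.assoc,
    ← associator_naturality_right]
  simp only [← Category.assoc, whisker_exchange]

theorem idR_naturality (u : SaavedraUnit b) {f f' : a ⟶ b} (η : f ⟶ f') :
    (u.idR f).hom ≫ η ▷ u.arrow = η ≫ (u.idR f').hom := by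
  apply u.whiskerRight_cancel
  rw [← cancel_mono (α_ f' u.arrow u.arrow).hom]
  simp only [comp_whiskerRight, idR_whiskerRight, Category.assoc,
    associator_naturality_left, Iso.inv_hom_id, Iso.inv_hom_id_assoc, Category.comp_id,
    whisker_exchange]

/-- The triangle identity after composition with `u`: here the defining equations of both identity
isomorphisms meet, linked by the pentagon. -/
theorem comp_whiskerLeft_idL (u : SaavedraUnit b) (f : a ⟶ b) (g : b ⟶ c) :
    (f ≫₁ u.arrow) ◁ (u.idL g).hom =
      (α_ f u.arrow g).hom ≫ (u.idR f).hom ▷ (u.arrow ≫₁ g) := by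
  have idR_square : f ◁ u.iso.hom = (u.idR f).hom ▷ u.arrow ≫ (α_ f u.arrow u.arrow).hom := by
    rw [idR_whiskerRight, Category.assoc, Iso.inv_hom_id, Category.comp_id]
  rw [← cancel_mono (α_ f u.arrow (u.arrow ≫₁ g)).hom]
  calc (f ≫₁ u.arrow) ◁ (u.idL g).hom ≫ (α_ f u.arrow (u.arrow ≫₁ g)).hom
      = (α_ f u.arrow g).hom ≫ f ◁ (u.iso.hom ▷ g) ≫ f ◁ (α_ u.arrow u.arrow g).hom := by
        rw [associator_naturality_right, whiskerLeft_idL, whiskerLeft_comp]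
    _ = (f ◁ u.iso.hom) ▷ g ≫ (α_ f (u.arrow ≫₁ u.arrow) g).hom ≫
          f ◁ (α_ u.arrow u.arrow g).hom := by
        rw [← Category.assoc, ← associator_naturality_middle, Category.assoc]
    _ = ((u.idR f).hom ▷ u.arrow) ▷ g ≫ (α_ (f ≫₁ u.arrow) u.arrow g).hom ≫
          (α_ f u.arrow (u.arrow ≫₁ g)).hom := by
        rw [idR_square, comp_whiskerRight, Category.assoc, pentagon]
    _ = ((α_ f u.arrow g).hom ≫ (u.idR f).hom ▷ (u.arrow ≫₁ g)) ≫
          (α_ f u.arrow (u.arrow ≫₁ g)).hom := by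
        rw [← Category.assoc, associator_naturality_left]

theorem triangle (u : SaavedraUnit b) (f : a ⟶ b) (g : b ⟶ c) :
    (u.idR f).hom ▷ g ≫ (α_ f u.arrow g).hom = f ◁ (u.idL g).hom := by
  rw [← cancel_mono ((u.idR f).hom ▷ (u.arrow ≫₁ g)), Category.assoc, ← comp_whiskerLeft_idL,
    whisker_exchange]

theorem idR_arrow (u : SaavedraUnit a) : u.idR u.arrow = u.iso := by
  ext
  apply u.whiskerRight_cancel
  rw [← cancel_mono (α_ u.arrow u.arrow u.arrow).hom, triangle,
    whiskerLeft_idL]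

theorem idL_arrow (u : SaavedraUnit a) : u.idL u.arrow = u.iso := by
  ext
  apply u.whiskerLeft_cancel
  rw [← triangle, idR_whiskerRight, Category.assoc, Iso.inv_hom_id,
    Category.comp_id]

end SaavedraUnit

/-- The bicategory whose identity 1-arrows are chosen Saavedra units. -/
@[reducible]
noncomputable def bicategoryOfUnits (u : ∀ a : B, SaavedraUnit a) : Bicategory.{w, v} B where
  Hom a b := a ⟶ b
  id a := (u a).arrow
  comp := comp
  homCategory a b := inferInstanceAs (Category (a ⟶ b))
  whiskerLeft f _ _ η := f ◁ η
  whiskerRight η g := η ▷ g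
  associator := associator
  leftUnitor f := ((u _).idL f).symm
  rightUnitor f := ((u _).idR f).symm
  whiskerLeft_id := whiskerLeft_id
  whiskerLeft_comp f _ _ _ := whiskerLeft_comp f
  id_whiskerLeft η := (Iso.eq_inv_comp _).2 ((u _).idL_naturality η)
  comp_whiskerLeft f g _ _ η := by
    rw [← Category.assoc, ← associator_naturality_right, Category.assoc, Iso.hom_inv_id,
      Category.comp_id]
  id_whiskerRight := id_whiskerRight
  comp_whiskerRight := comp_whiskerRight
  whiskerRight_id η := (Iso.eq_inv_comp _).2 ((u _).idR_naturality η)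
  whiskerRight_comp η g h := (Iso.eq_inv_comp _).2 (associator_naturality_left η g h).symm
  whisker_assoc f _ _ η h := by
    rw [← Category.assoc, ← associator_naturality_middle, Category.assoc, Iso.hom_inv_id,
      Category.comp_id]
  whisker_exchange := whisker_exchange
  pentagon := pentagon
  triangle {_ b _} f g := by
    change (α_ f (u b).arrow g).hom ≫ f ◁ ((u b).idL g).inv = ((u b).idR f).inv ▷ g
    rw [← cancel_epi (((u b).idR f).hom ▷ g), ← Category.assoc, (u b).triangle,
      ← whiskerLeft_comp, ← comp_whiskerRight, Iso.hom_inv_id, Iso.hom_inv_id, whiskerLeft_id,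
      id_whiskerRight]

end Semibicategory

theorem bijective_of_map_smul {M X Y : Type*} [Monoid M] [MulAction M X] [MulAction M Y]
    [MulAction.IsPretransitive M X] [MulAction.IsPretransitive M Y] [IsCancelSMul M Y] [Nonempty X]
    {φ : X → Y} (hφ : ∀ (c : M) (x : X), φ (c • x) = c • φ x) : Function.Bijective φ := by
  refine ⟨fun x x' h => ?_, fun y => ?_⟩
  · obtain ⟨c, rfl⟩ := MulAction.exists_smul_eq M x x'
    have c_eq_one : c = 1 := IsCancelSMul.eq_one_of_smul ((hφ c x).symm.trans h.symm)
    rw [c_eq_one, one_smul]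
  · obtain ⟨x⟩ : Nonempty X := inferInstance
    obtain ⟨c, hc⟩ := MulAction.exists_smul_eq M (φ x) y
    exact ⟨c • x, (hφ c x).trans hc⟩

namespace CStarBundle

variable {B : SmoothManifold.{u}} {S : Set B} (P : CStarBundle B S)

/-- The fibre of `P` over `b`, which is a torsor under `ℂˣ` if `b ∈ S`, and is empty otherwise. -/
def Fibre (b : B) : Type u := {q : P.total // P.proj q = b}

variable {P} {b : B}

instance : MulAction ℂˣ (P.Fibre b) where
  smul z q := ⟨z • q.1, (P.proj_smul z q.1).trans q.2⟩
  one_smul q := Subtype.ext (one_smul ℂˣ q.1)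
  mul_smul z w q := Subtype.ext (mul_smul z w q.1)

instance : MulAction.IsPretransitive ℂˣ (P.Fibre b) where
  exists_smul_eq q q' := by
    obtain ⟨z, hz⟩ := P.transitive q.1 q'.1 (q.2.trans q'.2.symm)
    exact ⟨z, Subtype.ext hz.symm⟩

instance : IsCancelSMul ℂˣ (P.Fibre b) where
  right_cancel' z w q h := by
    have h_free := P.free (w⁻¹ * z) q.1 <| by
      rw [mul_smul, inv_smul_eq_iff]
      exact congrArg Subtype.val h
    exact (inv_mul_eq_one.1 h_free).symm

theorem nonempty_fibre (hb : b ∈ S) : Nonempty (P.Fibre b) := by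
  obtain ⟨U, -, hU, s, -, -, proj_s, -⟩ := P.locally_trivial b hb
  exact ⟨s b, proj_s b ⟨hb, hU⟩⟩

end CStarBundle

namespace BundleGerbe

variable {B : SmoothManifold.{u}} {S : Set B} (G : BundleGerbe B S)

theorem proj_e (y : G.Y) : G.Q.proj (G.e y) = (y, y) := (G.exists_identity y).choose_spec.1

theorem e_mul_e (y : G.Y) : G.mul (G.e y) (G.e y) = G.e y := (G.exists_identity y).choose_spec.2

/-- The fibre of `Y` over `b`, made into a groupoid by the bundle gerbe product: the arrows
`y ⟶ y'` are the points of `Q_{(y, y')}`. -/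
def Fibre (b : B) : Type u := {y : G.Y // G.proj y = b}

namespace Fibre

variable {G} {b : B} {y y' y'' y''' : G.Fibre b}

noncomputable instance : CategoryStruct (G.Fibre b) where
  Hom y y' := G.Q.Fibre (y.1, y'.1)
  id y := ⟨G.e y.1, G.proj_e y.1⟩
  comp η θ := ⟨G.mul θ.1 η.1, by rw [G.proj_mul _ _ (by rw [θ.2, η.2]), θ.2, η.2]⟩

theorem hom_ext {η θ : y ⟶ y'} (h : η.1 = θ.1) : η = θ := Subtype.ext h

theorem proj_hom (η : y ⟶ y') : G.Q.proj η.1 = (y.1, y'.1) := η.2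

theorem composable (η : y ⟶ y') (θ : y' ⟶ y'') : (G.Q.proj θ.1).1 = (G.Q.proj η.1).2 := by
  rw [proj_hom θ, proj_hom η]

noncomputable instance : MulAction ℂˣ (y ⟶ y') :=
  inferInstanceAs (MulAction ℂˣ (G.Q.Fibre (y.1, y'.1)))

instance : MulAction.IsPretransitive ℂˣ (y ⟶ y') :=
  inferInstanceAs (MulAction.IsPretransitive ℂˣ (G.Q.Fibre (y.1, y'.1)))

instance : IsCancelSMul ℂˣ (y ⟶ y') :=
  inferInstanceAs (IsCancelSMul ℂˣ (G.Q.Fibre (y.1, y'.1)))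

instance : Nonempty (y ⟶ y') := CStarBundle.nonempty_fibre (y.2.trans y'.2.symm)

theorem comp_smul (η : y ⟶ y') (z : ℂˣ) (θ : y' ⟶ y'') : η ≫ (z • θ) = z • (η ≫ θ) :=
  hom_ext (G.smul_mul z θ.1 η.1 (composable η θ))

theorem smul_comp (z : ℂˣ) (η : y ⟶ y') (θ : y' ⟶ y'') : (z • η) ≫ θ = z • (η ≫ θ) :=
  hom_ext (G.mul_smul z θ.1 η.1 (composable η θ))

theorem comp_left_bijective (η : y ⟶ y') : Function.Bijective (fun θ : y' ⟶ y'' => η ≫ θ) :=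
  bijective_of_map_smul (comp_smul η)

theorem comp_right_bijective (θ : y' ⟶ y'') : Function.Bijective (fun η : y ⟶ y' => η ≫ θ) :=
  bijective_of_map_smul fun z η => smul_comp z η θ

theorem comp_assoc (η : y ⟶ y') (θ : y' ⟶ y'') (κ : y'' ⟶ y''') :
    (η ≫ θ) ≫ κ = η ≫ (θ ≫ κ) :=
  hom_ext (G.mul_assoc _ _ _ (composable θ κ) (composable η θ)).symm

theorem id_comp_id (y : G.Fibre b) : 𝟙 y ≫ 𝟙 y = 𝟙 y := hom_ext (G.e_mul_e y.1)

/- An idempotent with which one can cancel is a unit. -/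
noncomputable instance : Category (G.Fibre b) where
  id_comp {y _} η := (comp_left_bijective (𝟙 y)).injective <| by
    rw [← comp_assoc, id_comp_id]
  comp_id {_ y'} η := (comp_right_bijective (𝟙 y')).injective <| by
    rw [comp_assoc, id_comp_id]
  assoc := comp_assoc

instance (η : y ⟶ y') : IsIso η :=
  isIso_of_coyoneda_map_bijective η fun _ => comp_left_bijective η

end Fibre

end BundleGerbe

namespace BundleTwoGerbe

open Semibicategory

variable {G : BundleTwoGerbe.{u}}

/-- The 1-arrows `x ⟶ x'`: the points of `Y_{(x, x')}`. -/
abbrev OneArrow (x x' : G.X) : Type u := G.gerbe.Fibre (x, x')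

section HorizontalComposition

variable {x₁ x₂ x₃ x₄ x₅ : G.X}

theorem proj_oneArrow (f : OneArrow x₁ x₂) : G.gerbe.proj f.1 = (x₁, x₂) := f.2

theorem composable (f : OneArrow x₁ x₂) (g : OneArrow x₂ x₃) :
    (G.gerbe.proj g.1).1 = (G.gerbe.proj f.1).2 := by
  rw [proj_oneArrow g, proj_oneArrow f]

/-- The composition `g ∘ f` of 1-arrows given by `m`, in Mathlib's order. -/
def comp (f : OneArrow x₁ x₂) (g : OneArrow x₂ x₃) : OneArrow x₁ x₃ :=
  ⟨G.m g.1 f.1, by rw [G.proj_m _ _ (composable f g), proj_oneArrow g, proj_oneArrow f]⟩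

theorem proj_twoArrow {f f' : OneArrow x₁ x₂} (η : f ⟶ f') : G.gerbe.Q.proj η.1 = (f.1, f'.1) :=
  η.2

variable {f f' f'' : OneArrow x₁ x₂} {g g' g'' : OneArrow x₂ x₃} {h h' : OneArrow x₃ x₄}

theorem hcomposable (η : f ⟶ f') (θ : g ⟶ g') :
    (G.gerbe.proj (G.gerbe.Q.proj θ.1).1).1 = (G.gerbe.proj (G.gerbe.Q.proj η.1).1).2 := by
  rw [proj_twoArrow θ, proj_twoArrow η, composable f g]

/-- The horizontal composition of 2-arrows given by `mHat`, in the order of `comp`. -/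
def hcomp (η : f ⟶ f') (θ : g ⟶ g') : comp f g ⟶ comp f' g' :=
  ⟨G.mHat θ.1 η.1, by
    rw [G.proj_mHat _ _ (hcomposable η θ), proj_twoArrow θ, proj_twoArrow η]
    rfl⟩

theorem hcomp_comp_hcomp (η : f ⟶ f') (η' : f' ⟶ f'') (θ : g ⟶ g') (θ' : g' ⟶ g'') :
    hcomp η θ ≫ hcomp η' θ' = hcomp (η ≫ η') (θ ≫ θ') :=
  BundleGerbe.Fibre.hom_ext (G.mHat_mul _ _ _ _ (BundleGerbe.Fibre.composable θ θ')
    (BundleGerbe.Fibre.composable η η') (hcomposable η θ)).symm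

theorem hcomp_id (f : OneArrow x₁ x₂) (g : OneArrow x₂ x₃) : hcomp (𝟙 f) (𝟙 g) = 𝟙 (comp f g) := by
  rw [← cancel_epi (hcomp (𝟙 f) (𝟙 g)), hcomp_comp_hcomp]
  simp only [Category.comp_id]

theorem hcomp_inv (η : f ⟶ f') (θ : g ⟶ g') : inv (hcomp η θ) = hcomp (inv η) (inv θ) := by
  apply IsIso.inv_eq_of_hom_inv_id
  rw [hcomp_comp_hcomp, IsIso.hom_inv_id, IsIso.hom_inv_id, hcomp_id]

theorem hcomp_id_comp (f : OneArrow x₁ x₂) (θ : g ⟶ g') (θ' : g' ⟶ g'') :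
    hcomp (𝟙 f) (θ ≫ θ') = hcomp (𝟙 f) θ ≫ hcomp (𝟙 f) θ' := by
  rw [hcomp_comp_hcomp, Category.comp_id]

theorem hcomp_comp_id (η : f ⟶ f') (η' : f' ⟶ f'') (g : OneArrow x₂ x₃) :
    hcomp (η ≫ η') (𝟙 g) = hcomp η (𝟙 g) ≫ hcomp η' (𝟙 g) := by
  rw [hcomp_comp_hcomp, Category.comp_id]

theorem hcomp_id_comp_id_hcomp (η : f ⟶ f') (θ : g ⟶ g') :
    hcomp η (𝟙 g) ≫ hcomp (𝟙 f') θ = hcomp η θ := by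
  rw [hcomp_comp_hcomp, Category.comp_id, Category.id_comp]

theorem id_hcomp_comp_hcomp_id (η : f ⟶ f') (θ : g ⟶ g') :
    hcomp (𝟙 f) θ ≫ hcomp η (𝟙 g') = hcomp η θ := by
  rw [hcomp_comp_hcomp, Category.comp_id, Category.id_comp]

theorem hcomp_left_bijective (η : f ⟶ f') :
    Function.Bijective (fun θ : g ⟶ g' => hcomp η θ) :=
  bijective_of_map_smul fun z θ =>
    BundleGerbe.Fibre.hom_ext (G.smul_mHat z θ.1 η.1 (hcomposable η θ))

theorem hcomp_right_bijective (θ : g ⟶ g') :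
    Function.Bijective (fun η : f ⟶ f' => hcomp η θ) :=
  bijective_of_map_smul fun z η =>
    BundleGerbe.Fibre.hom_ext (G.mHat_smul z θ.1 η.1 (hcomposable η θ))

/-- The associativity 2-arrow `(h ∘ g) ∘ f ⟶ h ∘ (g ∘ f)` given by `aHat`; in Mathlib's order it
is the inverse of the associator. -/
def assoc (f : OneArrow x₁ x₂) (g : OneArrow x₂ x₃) (h : OneArrow x₃ x₄) :
    comp f (comp g h) ⟶ comp (comp f g) h :=
  ⟨G.aHat h.1 g.1 f.1, G.proj_aHat _ _ _ (composable g h) (composable f g)⟩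

theorem assoc_naturality (η : f ⟶ f') (θ : g ⟶ g') (κ : h ⟶ h') :
    assoc f g h ≫ hcomp (hcomp η θ) κ = hcomp η (hcomp θ κ) ≫ assoc f' g' h' := by
  have descent := G.aHat_descent κ.1 θ.1 η.1 (hcomposable θ κ) (hcomposable η θ)
  rw [proj_twoArrow η, proj_twoArrow θ, proj_twoArrow κ] at descent
  exact BundleGerbe.Fibre.hom_ext descent

theorem inv_assoc_naturality (η : f ⟶ f') (θ : g ⟶ g') (κ : h ⟶ h') :
    hcomp (hcomp η θ) κ ≫ inv (assoc f' g' h') = inv (assoc f g h) ≫ hcomp η (hcomp θ κ) := by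
  rw [IsIso.eq_inv_comp, ← Category.assoc, assoc_naturality, Category.assoc, IsIso.hom_inv_id,
    Category.comp_id]

theorem inv_assoc_naturality_left (η : f ⟶ f') (g : OneArrow x₂ x₃) (h : OneArrow x₃ x₄) :
    hcomp (hcomp η (𝟙 g)) (𝟙 h) ≫ inv (assoc f' g h) =
      inv (assoc f g h) ≫ hcomp η (𝟙 (comp g h)) := by
  rw [inv_assoc_naturality, hcomp_id]

theorem inv_assoc_naturality_right (f : OneArrow x₁ x₂) (g : OneArrow x₂ x₃) (κ : h ⟶ h') :
    hcomp (𝟙 (comp f g)) κ ≫ inv (assoc f g h') =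
      inv (assoc f g h) ≫ hcomp (𝟙 f) (hcomp (𝟙 g) κ) := by
  rw [← inv_assoc_naturality, hcomp_id]

theorem assoc_pentagon (f : OneArrow x₁ x₂) (g : OneArrow x₂ x₃) (h : OneArrow x₃ x₄)
    (k : OneArrow x₄ x₅) :
    (hcomp (𝟙 f) (assoc g h k) ≫ assoc f (comp g h) k) ≫ hcomp (assoc f g h) (𝟙 k) =
      assoc f g (comp h k) ≫ assoc (comp f g) h k :=
  BundleGerbe.Fibre.hom_ext <|
    G.aHat_coherence k.1 h.1 g.1 f.1 (composable h k) (composable g h) (composable f g)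

theorem inv_assoc_pentagon (f : OneArrow x₁ x₂) (g : OneArrow x₂ x₃) (h : OneArrow x₃ x₄)
    (k : OneArrow x₄ x₅) :
    hcomp (inv (assoc f g h)) (𝟙 k) ≫ inv (assoc f (comp g h) k) ≫
        hcomp (𝟙 f) (inv (assoc g h k)) =
      inv (assoc (comp f g) h k) ≫ inv (assoc f g (comp h k)) := by
  have hcomp_id_inv : hcomp (𝟙 f) (inv (assoc g h k)) = inv (hcomp (𝟙 f) (assoc g h k)) := by
    rw [hcomp_inv, IsIso.inv_id]
  have hcomp_inv_id : hcomp (inv (assoc f g h)) (𝟙 k) = inv (hcomp (assoc f g h) (𝟙 k)) := by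
    rw [hcomp_inv, IsIso.inv_id]
  rw [hcomp_id_inv, hcomp_inv_id, ← IsIso.inv_comp, ← IsIso.inv_comp, ← IsIso.inv_comp]
  exact IsIso.inv_eq_inv.2 (assoc_pentagon f g h k)

end HorizontalComposition

section FibreOverPoint

variable {p : G.M}

instance : Quiver (G.Fibre p) where
  Hom x x' := OneArrow x.1 x'.1

noncomputable instance (x x' : G.Fibre p) : Category.{u} (x ⟶ x') :=
  inferInstanceAs (Category (OneArrow x.1 x'.1))

noncomputable instance : Semibicategory (G.Fibre p) where
  comp := comp
  whiskerLeft f _ _ θ := hcomp (𝟙 f) θ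
  whiskerRight η g := hcomp η (𝟙 g)
  associator f g h := (asIso (assoc f g h)).symm
  whiskerLeft_id := hcomp_id
  whiskerLeft_comp f _ _ _ := hcomp_id_comp f
  id_whiskerRight := hcomp_id
  comp_whiskerRight := hcomp_comp_id
  whisker_exchange η θ := (id_hcomp_comp_hcomp_id η θ).trans (hcomp_id_comp_id_hcomp η θ).symm
  associator_naturality_left := inv_assoc_naturality_left
  associator_naturality_middle f _ _ η h := inv_assoc_naturality (𝟙 f) η (𝟙 h)
  associator_naturality_right f g _ _ := inv_assoc_naturality_right f g
  pentagon := inv_assoc_pentagon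

/-- Every loop `f` is a Saavedra unit: there is a 2-arrow `i : f ⟶ f ∘ f` because fibres are
nonempty, and one can cancel `f` because whiskering is a map of torsors. -/
noncomputable def unit {x : G.Fibre p} (f : OneArrow x.1 x.1) (i : f ⟶ comp f f) :
    SaavedraUnit x where
  arrow := f
  iso := let j : f ≅ comp f f := asIso i; j
  precomp_full _ := ⟨(hcomp_left_bijective (𝟙 f)).surjective⟩
  precomp_faithful _ := ⟨fun h => (hcomp_left_bijective (𝟙 f)).injective h⟩
  postcomp_full _ := ⟨(hcomp_right_bijective (𝟙 f)).surjective⟩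
  postcomp_faithful _ := ⟨fun h => (hcomp_right_bijective (𝟙 f)).injective h⟩

/-- `idL` and `idR` restrict, on the 1-arrows over `p`, to the identity isomorphisms of the
units `U`. -/
structure ExtendsUnitors (U : ∀ x : G.Fibre p, SaavedraUnit x) (idL idR : G.Y → G.Q) : Prop where
  idL_eq : ∀ {x₁ x₂ : G.Fibre p} (f : x₁ ⟶ x₂), idL f.1 = ((U x₁).idL f).hom.1
  idR_eq : ∀ {x₁ x₂ : G.Fibre p} (f : x₁ ⟶ x₂), idR f.1 = ((U x₂).idR f).hom.1

theorem arrow_val_injective :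
    Function.Injective (fun f : Σ x : G.Fibre p × G.Fibre p, (x.1 ⟶ x.2) => f.2.1) := by
  rintro ⟨⟨x₁, x₂⟩, f⟩ ⟨⟨x₁', x₂'⟩, f'⟩ (h : f.1 = f'.1)
  have ends_eq : (x₁.1, x₂.1) = (x₁'.1, x₂'.1) := by rw [← proj_oneArrow f, h, proj_oneArrow f']
  obtain rfl : x₁ = x₁' := Subtype.ext (congrArg Prod.fst ends_eq)
  obtain rfl : x₂ = x₂' := Subtype.ext (congrArg Prod.snd ends_eq)
  obtain rfl : f = f' := Subtype.ext h
  rfl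

theorem exists_extendsUnitors (U : ∀ x : G.Fibre p, SaavedraUnit x) :
    ∃ idL idR : G.Y → G.Q, ExtendsUnitors U idL idR :=
  ⟨Function.extend _ (fun f : Σ x : G.Fibre p × G.Fibre p, (x.1 ⟶ x.2) =>
      ((U f.1.1).idL f.2).hom.1) G.e,
    Function.extend _ (fun f : Σ x : G.Fibre p × G.Fibre p, (x.1 ⟶ x.2) =>
      ((U f.1.2).idR f.2).hom.1) G.e,
    fun {x₁ x₂} f => arrow_val_injective.extend_apply _ _ ⟨(x₁, x₂), f⟩,
    fun {x₁ x₂} f => arrow_val_injective.extend_apply _ _ ⟨(x₁, x₂), f⟩⟩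

namespace ExtendsUnitors

variable {U : ∀ x : G.Fibre p, SaavedraUnit x} {idL idR : G.Y → G.Q}

theorem isIdentityChoice (hU : ExtendsUnitors U idL idR) :
    IsIdentityChoice (fun x => (U x).arrow.1) idL idR where
  projQ_idL x₁ x₂ y hy := by
    let f : x₁ ⟶ x₂ := ⟨y, hy⟩
    rw [hU.idL_eq f]
    exact ((U x₁).idL f).hom.2
  projQ_idR x₁ x₂ y hy := by
    let f : x₁ ⟶ x₂ := ⟨y, hy⟩
    rw [hU.idR_eq f]
    exact ((U x₂).idR f).hom.2
  idL_descent x₁ x₂ q hq := by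
    let f : x₁ ⟶ x₂ := ⟨_, hq⟩
    let f' : x₁ ⟶ x₂ := ⟨_, (G.gerbe.Q.proj_mem q).symm.trans hq⟩
    let η : f ⟶ f' := ⟨q, rfl⟩
    rw [hU.idL_eq f, hU.idL_eq f']
    exact congrArg Subtype.val ((U x₁).idL_naturality η)
  idR_descent x₁ x₂ q hq := by
    let f : x₁ ⟶ x₂ := ⟨_, hq⟩
    let f' : x₁ ⟶ x₂ := ⟨_, (G.gerbe.Q.proj_mem q).symm.trans hq⟩
    let η : f ⟶ f' := ⟨q, rfl⟩
    rw [hU.idR_eq f, hU.idR_eq f']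
    exact congrArg Subtype.val ((U x₂).idR_naturality η)
  idL_eq_idR x := by
    rw [hU.idL_eq, hU.idR_eq, SaavedraUnit.idL_arrow, SaavedraUnit.idR_arrow]
  idR_normalised x₁ x₂ y hy := by
    let f : x₁ ⟶ x₂ := ⟨y, hy⟩
    rw [hU.idR_eq f, hU.idL_eq, SaavedraUnit.idL_arrow]
    exact congrArg Subtype.val ((U x₂).idR_whiskerRight f).symm
  idL_normalised x₁ x₂ y hy := by
    let f : x₁ ⟶ x₂ := ⟨y, hy⟩
    rw [hU.idL_eq f, hU.idR_eq, SaavedraUnit.idR_arrow]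
    exact congrArg Subtype.val ((U x₁).whiskerLeft_idL_comp_associator_inv f)

/-- The bicategory `Q_p` of the units `U`, with its identification with the bundle 2-gerbe data. -/
noncomputable def fibreBicategory (hU : ExtendsUnitors U idL idR) :
    FibreBicategory (fun x => (U x).arrow.1) idL idR :=
  letI := bicategoryOfUnits U
  { oneArrow := Equiv.refl _
    twoArrow := Equiv.refl _
    twoArrow_comp := fun _ _ => rfl
    twoArrow_id := fun _ => rfl
    oneArrow_comp := fun _ _ => rfl
    twoArrow_hcomp := fun η θ => 
      congrArg Subtype.val (hcomp_id_comp_id_hcomp η θ)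
    twoArrow_whiskerLeft := fun _ _ _ _ => rfl
    twoArrow_whiskerRight := fun _ _ => rfl
    twoArrow_associator := fun _ _ _ => rfl
    oneArrow_id := fun _ => rfl
    twoArrow_leftUnitor := fun f => (hU.idL_eq f).symm
    twoArrow_rightUnitor := fun f => (hU.idR_eq f).symm }

end ExtendsUnitors

namespace IsIdentityChoice

variable {I : G.Fibre p → G.Y} {idL idR : G.Y → G.Q}

/-- The Saavedra units with arrows `I x` and isomorphisms `idL (I x)`. -/
noncomputable def units (hI : IsDiagonalSection I) (hid : IsIdentityChoice I idL idR)
    (x : G.Fibre p) : SaavedraUnit x :=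
  unit ⟨I x, hI x⟩ ⟨idL (I x), hid.projQ_idL x x (I x) (hI x)⟩

theorem extendsUnitors (hI : IsDiagonalSection I) (hid : IsIdentityChoice I idL idR) :
    ExtendsUnitors (hid.units hI) idL idR where
  idL_eq {x₁ x₂} f := by
    let L : f ⟶ comp (hid.units hI x₁).arrow f := ⟨idL f.1, hid.projQ_idL x₁ x₂ f.1 f.2⟩
    have L_eq : L = ((hid.units hI x₁).idL f).hom := by
      apply SaavedraUnit.idL_unique
      have normalised := hid.idL_normalised x₁ x₂ f.1 f.2
      rw [← hid.idL_eq_idR] at normalised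
      exact BundleGerbe.Fibre.hom_ext normalised
    exact congrArg Subtype.val L_eq
  idR_eq {x₁ x₂} f := by
    let R : f ⟶ comp f (hid.units hI x₂).arrow := ⟨idR f.1, hid.projQ_idR x₁ x₂ f.1 f.2⟩
    have R_eq : R = ((hid.units hI x₂).idR f).hom := by
      apply SaavedraUnit.idR_unique
      exact BundleGerbe.Fibre.hom_ext (hid.idR_normalised x₁ x₂ f.1 f.2).symm
    exact congrArg Subtype.val R_eq

end IsIdentityChoice

theorem exists_isDiagonalSection (p : G.M) : ∃ I : G.Fibre p → G.Y, IsDiagonalSection I := by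
  have nonempty_fibre (x : G.Fibre p) : ∃ y : G.Y, G.projY y = (x.1, x.1) := by
    have mem_range : (x.1, x.1) ∈ Set.range G.gerbe.proj := by
      rw [G.gerbe.proj_surj.range_eq]
      rfl
    exact mem_range
  exact ⟨fun x => (nonempty_fibre x).choose, fun x => (nonempty_fibre x).choose_spec⟩

theorem exists_isIdentityChoice {I : G.Fibre p → G.Y} (hI : IsDiagonalSection I) :
    ∃ idL idR : G.Y → G.Q, IsIdentityChoice I idL idR := by
  obtain ⟨idL, idR, hU⟩ :=
    exists_extendsUnitors fun x : G.Fibre p =>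
      let f : OneArrow x.1 x.1 := ⟨I x, hI x⟩
      unit f (Classical.arbitrary (f ⟶ comp f f))
  exact ⟨idL, idR, hU.isIdentityChoice⟩

end FibreOverPoint

end BundleTwoGerbe

theorem mainTheorem9 (G : BundleTwoGerbe.{u}) (p : G.M) :
    (∃ I : G.Fibre p → G.Y, BundleTwoGerbe.IsDiagonalSection I) ∧
    ∀ I : G.Fibre p → G.Y, BundleTwoGerbe.IsDiagonalSection I →
      (∃ idL idR : G.Y → G.Q, BundleTwoGerbe.IsIdentityChoice I idL idR) ∧
      ∀ idL idR : G.Y → G.Q, BundleTwoGerbe.IsIdentityChoice I idL idR →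
        Nonempty (BundleTwoGerbe.FibreBicategory I idL idR) :=
  ⟨BundleTwoGerbe.exists_isDiagonalSection p, fun _ hI =>
    ⟨BundleTwoGerbe.exists_isIdentityChoice hI, fun _ _ hid =>
      ⟨(hid.extendsUnitors hI).fibreBicategory⟩⟩⟩
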